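/- Let $d\ge 2$, let $s$ be a random vector uniformly distributed on the unit sphere $S^{d-1}=\{x\in\mathbb{R}^d:\|x\|_2=1\}$, let $u\in\mathbb{R}^d$ be a unit vector, let $\lambda_{\max}>0$ and put $G:=\lambda_{\max}\,uu^\top$. Then \[ \frac{s^\top G s}{\lambda_{\max}}=(u^\top s)^2\;\overset{d}{=}\;s_1^2\;\sim\;\mathrm{Beta}\!\left(\tfrac12,\tfrac{d-1}{2}\right), \] where $s_1$ is the first coordinate of $s$ and $\overset{d}{=}$ denotes equality in distribution. In particular, if $m>0$ and $c:=m\,s$, then $\|c\|_2=m$ almost surely, and \[ c^\top G c\;\overset{d}{=}\;\lambda_{\max}\,\|c\|_2^2\,Z \] for every real random variable $Z\sim\mathrm{Beta}\!\left(\tfrac12,\tfrac{d-1}{2}\right)$. Here $Z$ may be defined on the probability space of $s$, with any dependence on $s$, or on another probability space, in which case $\|c\|_2$ stands for its constant value $m$. -/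

import Mathlib

open MeasureTheory ProbabilityTheory Matrix

/-- The uniform distribution on the Euclidean unit sphere of `ℝ^d`, as a measure on `ℝ^d`:
the surface measure of the sphere divided by its total mass (for `1 ≤ d`). -/
noncomputable def sphereUniform (d : ℕ) : Measure (EuclideanSpace ℝ (Fin d)) :=
  Measure.map Subtype.val
    (((volume : Measure (EuclideanSpace ℝ (Fin d))).toSphere Set.univ)⁻¹ •
      (volume : Measure (EuclideanSpace ℝ (Fin d))).toSphere)

/-- The quadratic form `xᵀ G x`. -/
def quadForm {d : ℕ} (G : Matrix (Fin d) (Fin d) ℝ) (x : EuclideanSpace ℝ (Fin d)) : ℝ :=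
  x.ofLp ⬝ᵥ (G *ᵥ x.ofLp)

/-! The law of `⟪u, s⟫ ^ 2` and the Beta law both live on `[0, 1]`, so it suffices to match moments
(`ext_of_forall_integral_pow_eq`). The spherical moments come from evaluating the integral of `⟪u,
x⟫ ^ (2 * k) * exp (-‖x‖ ^ 2)` twice: in an orthonormal basis containing `u` it factors into
one-dimensional Gamma integrals, and in polar coordinates it is the spherical moment times a radial
Gamma integral. Dividing by the case `k = 0` gives the ratio of beta functions in
`integral_pow_betaMeasure`. -/

/-- Finite measures carried by `[0, 1]` are determined by their moments. -/
theorem ext_of_forall_integral_pow_eq {μ ν : Measure ℝ} [IsFiniteMeasure μ] [IsFiniteMeasure ν]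
    (hμ : ∀ᵐ x ∂μ, x ∈ Set.Icc (0 : ℝ) 1) (hν : ∀ᵐ x ∂ν, x ∈ Set.Icc (0 : ℝ) 1)
    (h : ∀ k : ℕ, ∫ x, x ^ k ∂μ = ∫ x, x ^ k ∂ν) : μ = ν := by
  have integrable_of {ρ : Measure ℝ} [IsFiniteMeasure ρ] (hρ : ∀ᵐ x ∂ρ, x ∈ Set.Icc (0 : ℝ) 1)
      {g : ℝ → ℝ} (hg : Continuous g) : Integrable g ρ := by
    obtain ⟨C, hC⟩ := isCompact_Icc.exists_bound_of_continuousOn (s := Set.Icc (0 : ℝ) 1)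
      hg.continuousOn
    exact Integrable.of_bound hg.aestronglyMeasurable C (hρ.mono hC)
  have poly (p : Polynomial ℝ) : ∫ x, p.eval x ∂μ = ∫ x, p.eval x ∂ν := by
    simp_rw [Polynomial.eval_eq_sum_range]
    rw [integral_finsetSum _ fun i _ => integrable_of hμ (by fun_prop),
      integral_finsetSum _ fun i _ => integrable_of hν (by fun_prop)]
    simp_rw [integral_const_mul, h]
  have close {ρ : Measure ℝ} [IsFiniteMeasure ρ] (hρ : ∀ᵐ x ∂ρ, x ∈ Set.Icc (0 : ℝ) 1)
      {f : ℝ → ℝ} (hf : Continuous f) {p : Polynomial ℝ} {ε : ℝ}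
      (hp : ∀ x ∈ Set.Icc (0 : ℝ) 1, |p.eval x - f x| < ε) :
      |∫ x, p.eval x ∂ρ - ∫ x, f x ∂ρ| ≤ ε * ρ.real Set.univ := by
    rw [← integral_sub (integrable_of hρ p.continuous) (integrable_of hρ hf)]
    exact norm_integral_le_of_norm_le_const
      (hρ.mono fun x hx => (Real.norm_eq_abs _).trans_le (hp x hx).le)
  refine ext_of_forall_integral_eq_of_IsFiniteMeasure fun f => ?_
  rw [← sub_eq_zero, ← abs_nonpos_iff]
  refine le_of_forall_pos_le_add fun δ hδ => ?_
  -- The `+ 1` keeps the denominator positive even if both measures vanish.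
  have hM : 0 < μ.real Set.univ + ν.real Set.univ + 1 := by positivity
  obtain ⟨p, hp⟩ := exists_polynomial_near_of_continuousOn 0 1 f f.continuous.continuousOn
    (δ / (μ.real Set.univ + ν.real Set.univ + 1)) (by positivity)
  have h1 := close hμ f.continuous hp
  have h2 := close hν f.continuous hp
  rw [poly p, abs_sub_comm] at h1
  have h3 := abs_sub_le (∫ x, f x ∂μ) (∫ x, p.eval x ∂ν) (∫ x, f x ∂ν)
  have h4 : δ / (μ.real Set.univ + ν.real Set.univ + 1) *
      (μ.real Set.univ + ν.real Set.univ + 1) = δ := by field_simp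
  have h5 : 0 < δ / (μ.real Set.univ + ν.real Set.univ + 1) := by positivity
  nlinarith

/-! ### Moments of the Beta distribution -/

theorem measurable_betaPDF (a b : ℝ) : Measurable (betaPDF a b) :=
  (measurable_betaPDFReal a b).ennreal_ofReal

theorem betaPDFReal_nonneg {a b : ℝ} (ha : 0 < a) (hb : 0 < b) (x : ℝ) :
    0 ≤ betaPDFReal a b x := by
  by_cases hx : 0 < x ∧ x < 1
  · exact (betaPDFReal_pos hx.1 hx.2 ha hb).le
  · simp [betaPDFReal, hx]

theorem integral_betaPDFReal {a b : ℝ} (ha : 0 < a) (hb : 0 < b) :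
    ∫ x, betaPDFReal a b x = 1 := by
  rw [integral_eq_lintegral_of_nonneg_ae (.of_forall (betaPDFReal_nonneg ha hb))
    (measurable_betaPDFReal a b).aestronglyMeasurable]
  change (∫⁻ x, betaPDF a b x).toReal = 1
  simp [lintegral_betaPDF_eq_one ha hb]

/-- The factor `x ^ k` only shifts the first parameter, so each moment is a ratio of normalizing
constants. -/
theorem pow_mul_betaPDFReal {a b : ℝ} (ha : 0 < a) (hb : 0 < b) (k : ℕ) (x : ℝ) :
    betaPDFReal a b x * x ^ k = beta (a + k) b / beta a b * betaPDFReal (a + k) b x := by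
  by_cases hx : 0 < x ∧ x < 1
  · have h1 := (beta_pos ha hb).ne'
    have h2 := (beta_pos (show 0 < a + k by positivity) hb).ne'
    rw [betaPDFReal, betaPDFReal, if_pos hx, if_pos hx,
      show a + k - 1 = (a - 1) + k by ring, Real.rpow_add_natCast hx.1.ne']
    field_simp
  · simp [betaPDFReal, hx]

theorem integral_pow_betaMeasure {a b : ℝ} (ha : 0 < a) (hb : 0 < b) (k : ℕ) :
    ∫ x, x ^ k ∂betaMeasure a b = beta (a + k) b / beta a b := by
  rw [betaMeasure, integral_withDensity_eq_integral_toReal_smul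
    (measurable_betaPDF a b) (.of_forall fun x => by simp [betaPDF])]
  simp only [betaPDF, ENNReal.toReal_ofReal (betaPDFReal_nonneg ha hb _), smul_eq_mul,
    pow_mul_betaPDFReal ha hb]
  rw [integral_const_mul, integral_betaPDFReal (by positivity) hb, mul_one]

theorem ae_betaMeasure_mem_Icc (a b : ℝ) : ∀ᵐ x ∂betaMeasure a b, x ∈ Set.Icc (0 : ℝ) 1 := by
  rw [betaMeasure, ae_withDensity_iff (measurable_betaPDF a b)]
  refine .of_forall fun x hx => ?_
  by_contra h
  refine hx ?_
  rw [Set.mem_Icc, not_and_or, not_le, not_le] at h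
  rcases h with h | h
  · exact betaPDF_eq_zero_of_nonpos h.le
  · exact betaPDF_eq_zero_of_one_le h.le

/-! ### Gaussian integrals in Cartesian and polar coordinates -/

theorem integral_Ioi_pow_mul_exp_neg_sq (n : ℕ) :
    ∫ r in Set.Ioi (0 : ℝ), r ^ n * Real.exp (-r ^ 2) = 1 / 2 * Real.Gamma ((n + 1) / 2) := by
  have := integral_rpow_mul_exp_neg_rpow (p := 2) (q := n) (by norm_num)
    (by linarith [n.cast_nonneg (α := ℝ)])
  simpa [Real.rpow_natCast] using this

theorem integral_pow_mul_exp_neg_sq (k : ℕ) :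
    ∫ t : ℝ, t ^ (2 * k) * Real.exp (-t ^ 2) = Real.Gamma (1 / 2 + k) := by
  have := integral_comp_abs (f := fun t : ℝ => t ^ (2 * k) * Real.exp (-t ^ 2))
  simp only [sq_abs, (even_two_mul k).pow_abs] at this
  rw [this, integral_Ioi_pow_mul_exp_neg_sq]
  push_cast
  ring_nf

theorem EuclideanSpace.integral_coord_pow_mul_exp_neg_norm_sq {ι : Type*} [Fintype ι]
    (i : ι) (k : ℕ) :
    ∫ x : EuclideanSpace ℝ ι, x i ^ (2 * k) * Real.exp (-‖x‖ ^ 2) =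
      Real.Gamma (1 / 2 + k) * Real.Gamma (1 / 2) ^ (Fintype.card ι - 1) := by
  classical
  have h1 := (EuclideanSpace.volume_preserving_symm_measurableEquiv_toLp ι).integral_comp'
    (fun y : ι → ℝ => ∏ j, (if j = i then y j ^ (2 * k) else 1) * Real.exp (-y j ^ 2))
  have h2 := integral_fintype_prod_volume_eq_prod
    (fun (j : ι) (t : ℝ) => (if j = i then t ^ (2 * k) else 1) * Real.exp (-t ^ 2))
  rw [h2] at h1
  convert! h1 using 1
  · refine integral_congr_ae (.of_forall fun x => ?_)
    dsimp only
    rw [Finset.prod_mul_distrib, ← Real.exp_sum, Finset.sum_neg_distrib]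
    simp [EuclideanSpace.norm_sq_eq]
  · rw [← Finset.mul_prod_erase _ _ (Finset.mem_univ i)]
    have h0 : ∫ t : ℝ, Real.exp (-t ^ 2) = Real.Gamma (1 / 2) := by
      simpa using integral_pow_mul_exp_neg_sq 0
    congr 1
    · simp [integral_pow_mul_exp_neg_sq]
    · rw [Finset.prod_congr rfl (g := fun _ => Real.Gamma (1 / 2)) fun j hj => ?_]
      · simp
      · simp [(Finset.mem_erase.1 hj).1, h0]

open scoped RealInnerProductSpace

section InnerProductSpace

variable {E : Type*} [NormedAddCommGroup E] [InnerProductSpace ℝ E] [FiniteDimensional ℝ E]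
  [MeasurableSpace E] [BorelSpace E]

/-- Coordinates in an orthonormal basis preserve volume and norm, so `u` may be taken as a basis
vector. -/
theorem integral_inner_pow_mul_exp_neg_norm_sq {u : E} (hu : ‖u‖ = 1) (k : ℕ) :
    ∫ x, ⟪u, x⟫ ^ (2 * k) * Real.exp (-‖x‖ ^ 2) =
      Real.Gamma (1 / 2 + k) * Real.Gamma (1 / 2) ^ (Module.finrank ℝ E - 1) := by
  have : Nontrivial E := ⟨u, 0, fun h => by simp [h] at hu⟩
  let i : Fin (Module.finrank ℝ E) := ⟨0, Module.finrank_pos⟩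
  obtain ⟨b, hb⟩ := Orthonormal.exists_orthonormalBasis_extension_of_card_eq (𝕜 := ℝ) (E := E)
    (ι := Fin (Module.finrank ℝ E)) (by simp) (v := fun _ => u) (s := {i})
    ⟨fun _ => by simpa using hu, fun a b hab => (hab (Subsingleton.elim a b)).elim⟩
  have hbi : b i = u := hb i rfl
  have h := b.measurePreserving_repr.integral_comp b.repr.toHomeomorph.measurableEmbedding
    (fun x => x i ^ (2 * k) * Real.exp (-‖x‖ ^ 2))
  rw [EuclideanSpace.integral_coord_pow_mul_exp_neg_norm_sq] at h
  simpa [b.repr_apply_apply, hbi] using h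

/-- With `x = r • s`, homogeneity pulls out `r ^ n` and the integrand splits into a spherical and a
radial factor. -/
theorem integral_inner_pow_mul_exp_neg_norm_sq_eq_toSphere [Nontrivial E] (μ : Measure E)
    [μ.IsAddHaarMeasure] (u : E) (n : ℕ) :
    ∫ x, ⟪u, x⟫ ^ n * Real.exp (-‖x‖ ^ 2) ∂μ =
      (∫ s : Metric.sphere (0 : E) 1, ⟪u, (s : E)⟫ ^ n ∂μ.toSphere) *
        (1 / 2 * Real.Gamma ((n + Module.finrank ℝ E) / 2)) := by
  -- The radial density is `r ^ m`, with `m` one less than the dimension.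
  set m := Module.finrank ℝ E - 1 with hm
  have hd : Module.finrank ℝ E = m + 1 := by
    have := Module.finrank_pos (R := ℝ) (M := E); omega
  have radial : ∫ r : Set.Ioi (0 : ℝ), (r : ℝ) ^ n * Real.exp (-(r : ℝ) ^ 2)
      ∂Measure.volumeIoiPow m = 1 / 2 * Real.Gamma ((n + Module.finrank ℝ E) / 2) := by
    rw [Measure.volumeIoiPow, integral_withDensity_eq_integral_toReal_smul (by fun_prop)
      (.of_forall fun x => by simp)]
    rw [integral_subtype_comap measurableSet_Ioi
      (fun r : ℝ => (ENNReal.ofReal (r ^ m)).toReal • (r ^ n * Real.exp (-r ^ 2)))]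
    rw [setIntegral_congr_fun (g := fun r : ℝ => r ^ (n + m) * Real.exp (-r ^ 2)) measurableSet_Ioi,
      integral_Ioi_pow_mul_exp_neg_sq, hd]
    · push_cast
      ring_nf
    · intro r hr
      simp only [smul_eq_mul]
      rw [ENNReal.toReal_ofReal (pow_nonneg (le_of_lt hr) _)]
      ring
  calc
    _ = ∫ x : ({0}ᶜ : Set E), ⟪u, (x : E)⟫ ^ n * Real.exp (-‖(x : E)‖ ^ 2) ∂μ.comap (↑) := by
      rw [integral_subtype_comap (measurableSet_singleton _).compl
        fun x => ⟪u, x⟫ ^ n * Real.exp (-‖x‖ ^ 2), restrict_compl_singleton]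
    _ = ∫ z, ⟪u, (z.1 : E)⟫ ^ n * ((z.2 : ℝ) ^ n * Real.exp (-(z.2 : ℝ) ^ 2))
          ∂μ.toSphere.prod (.volumeIoiPow m) := by
      rw [← μ.measurePreserving_homeomorphUnitSphereProd.integral_comp
        (Homeomorph.measurableEmbedding _)]
      refine integral_congr_ae (.of_forall fun x => ?_)
      have hx : ‖(x : E)‖ ≠ 0 := norm_ne_zero_iff.2 x.2
      simp only [homeomorphUnitSphereProd_apply_fst_coe, homeomorphUnitSphereProd_apply_snd_coe,
        inner_smul_right]
      rw [← mul_assoc, ← mul_pow]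
      field_simp
    _ = _ := by
      rw [integral_prod_mul (fun s : Metric.sphere (0 : E) 1 => ⟪u, (s : E)⟫ ^ n)
        (fun r : Set.Ioi (0 : ℝ) => (r : ℝ) ^ n * Real.exp (-(r : ℝ) ^ 2)), radial]

theorem integral_inner_pow_toSphere {u : E} (hu : ‖u‖ = 1) (k : ℕ) :
    ∫ s : Metric.sphere (0 : E) 1, ⟪u, (s : E)⟫ ^ (2 * k) ∂(volume : Measure E).toSphere =
      2 * Real.Gamma (1 / 2) ^ (Module.finrank ℝ E - 1) *
        (Real.Gamma (1 / 2 + k) / Real.Gamma (k + Module.finrank ℝ E / 2)) := by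
  have : Nontrivial E := ⟨u, 0, fun h => by simp [h] at hu⟩
  have hd : (0 : ℝ) < Module.finrank ℝ E := by exact_mod_cast Module.finrank_pos (R := ℝ) (M := E)
  have h := integral_inner_pow_mul_exp_neg_norm_sq_eq_toSphere (volume : Measure E) u (2 * k)
  rw [integral_inner_pow_mul_exp_neg_norm_sq hu,
    show ((2 * k : ℕ) + Module.finrank ℝ E : ℝ) / 2 = k + Module.finrank ℝ E / 2 by
      push_cast; ring] at h
  have hG := (Real.Gamma_pos_of_pos (show (0 : ℝ) < k + Module.finrank ℝ E / 2 by positivity)).ne'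
  field_simp at h ⊢
  linarith

end InnerProductSpace

/-! ### The uniform law on the sphere -/

theorem toSphere_univ_ne_zero_and_ne_top {d : ℕ} (hd : 1 ≤ d) :
    (volume : Measure (EuclideanSpace ℝ (Fin d))).toSphere Set.univ ≠ 0 ∧
      (volume : Measure (EuclideanSpace ℝ (Fin d))).toSphere Set.univ ≠ ⊤ := by
  have : Nonempty (Fin d) := ⟨⟨0, hd⟩⟩
  exact ⟨Measure.measure_univ_ne_zero.2 (Measure.toSphere_ne_zero _),
    measure_ne_top _ _⟩

theorem isProbabilityMeasure_sphereUniform {d : ℕ} (hd : 1 ≤ d) :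
    IsProbabilityMeasure (sphereUniform d) := by
  obtain ⟨h0, h1⟩ := toSphere_univ_ne_zero_and_ne_top hd
  refine ⟨?_⟩
  rw [sphereUniform, Measure.map_apply measurable_subtype_coe .univ, Set.preimage_univ,
    Measure.smul_apply, smul_eq_mul, ENNReal.inv_mul_cancel h0 h1]

theorem ae_sphereUniform_norm_eq_one (d : ℕ) : ∀ᵐ x ∂sphereUniform d, ‖x‖ = 1 := by
  rw [sphereUniform, ae_map_iff measurable_subtype_coe.aemeasurable
    (measurableSet_eq_fun (by fun_prop) (by fun_prop))]
  exact .of_forall fun x => by simp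

theorem integral_sphereUniform {d : ℕ} {f : EuclideanSpace ℝ (Fin d) → ℝ} :
    ∫ x, f x ∂sphereUniform d =
      (∫ s, f s ∂(volume : Measure (EuclideanSpace ℝ (Fin d))).toSphere) /
        (volume : Measure (EuclideanSpace ℝ (Fin d))).toSphere.real Set.univ := by
  rw [sphereUniform, (MeasurableEmbedding.subtype_coe
    Metric.isClosed_sphere.measurableSet).integral_map, integral_smul_measure, smul_eq_mul,
    ENNReal.toReal_inv, div_eq_inv_mul, Measure.real]

/-- The even moments of a one-dimensional marginal of the uniform law on the sphere. -/
theorem integral_inner_pow_sphereUniform {d : ℕ} (hd : 2 ≤ d) {u : EuclideanSpace ℝ (Fin d)}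
    (hu : ‖u‖ = 1) (k : ℕ) :
    ∫ x, ⟪u, x⟫ ^ (2 * k) ∂sphereUniform d =
      beta (1 / 2 + k) (((d : ℝ) - 1) / 2) / beta (1 / 2) (((d : ℝ) - 1) / 2) := by
  have hd' : (2 : ℝ) ≤ d := by exact_mod_cast hd
  -- The zeroth moment is the total mass of the sphere, the normalizing constant.
  have h0 := integral_inner_pow_toSphere hu 0
  simp only [mul_zero, pow_zero, integral_const, smul_eq_mul, mul_one, Nat.cast_zero, add_zero,
    zero_add] at h0
  rw [integral_sphereUniform, integral_inner_pow_toSphere hu, h0, beta, beta,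
    show (1 : ℝ) / 2 + k + (d - 1) / 2 = k + d / 2 by ring,
    show (1 : ℝ) / 2 + (d - 1) / 2 = d / 2 by ring, finrank_euclideanSpace_fin]
  have g1 := (Real.Gamma_pos_of_pos (show (0 : ℝ) < 1 / 2 by norm_num)).ne'
  have g2 := (Real.Gamma_pos_of_pos (show (0 : ℝ) < ((d : ℝ) - 1) / 2 by linarith)).ne'
  have g3 := (Real.Gamma_pos_of_pos (show (0 : ℝ) < k + (d : ℝ) / 2 by positivity)).ne'
  have g4 := (Real.Gamma_pos_of_pos (show (0 : ℝ) < (d : ℝ) / 2 by positivity)).ne'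
  have g5 := pow_ne_zero (d - 1) g1
  generalize Real.Gamma (1 / 2) ^ (d - 1) = A at g5 ⊢
  generalize Real.Gamma (1 / 2) = B at *
  generalize Real.Gamma (1 / 2 + k) = C at *
  generalize Real.Gamma ((d : ℝ) / 2) = D at *
  generalize Real.Gamma (k + (d : ℝ) / 2) = F at *
  generalize Real.Gamma (((d : ℝ) - 1) / 2) = H at *
  field_simp

theorem hasLaw_inner_sq_sphereUniform {d : ℕ} (hd : 2 ≤ d) {u : EuclideanSpace ℝ (Fin d)}
    (hu : ‖u‖ = 1) :
    HasLaw (fun x => ⟪u, x⟫ ^ 2) (betaMeasure (1 / 2) (((d : ℝ) - 1) / 2)) (sphereUniform d) := by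
  have hb : 0 < ((d : ℝ) - 1) / 2 := by
    have : (2 : ℝ) ≤ d := by exact_mod_cast hd
    linarith
  have hm : Measurable fun x : EuclideanSpace ℝ (Fin d) => ⟪u, x⟫ ^ 2 := by fun_prop
  have := isProbabilityMeasure_sphereUniform (show 1 ≤ d by omega)
  have := isProbabilityMeasureBeta (show (0 : ℝ) < 1 / 2 by norm_num) hb
  have := Measure.isProbabilityMeasure_map (μ := sphereUniform d) hm.aemeasurable
  refine ⟨hm.aemeasurable, ext_of_forall_integral_pow_eq ?_ (ae_betaMeasure_mem_Icc _ _) fun k => ?_⟩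
  · refine (ae_map_iff hm.aemeasurable measurableSet_Icc).2 ?_
    filter_upwards [ae_sphereUniform_norm_eq_one d] with x hx
    have := abs_real_inner_le_norm u x
    rw [hu, hx, one_mul] at this
    exact ⟨sq_nonneg _, (sq_le_one_iff_abs_le_one _).2 this⟩
  · rw [integral_map hm.aemeasurable (by fun_prop), integral_pow_betaMeasure (by norm_num) hb,
      ← integral_inner_pow_sphereUniform hd hu]
    simp_rw [pow_mul]

theorem ofLp_dotProduct_ofLp_eq_inner {d : ℕ} (u x : EuclideanSpace ℝ (Fin d)) :
    u.ofLp ⬝ᵥ x.ofLp = ⟪u, x⟫ := by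
  rw [EuclideanSpace.inner_eq_star_dotProduct, star_trivial, dotProduct_comm]

theorem quadForm_smul_vecMulVec {d : ℕ} (a : ℝ) (u x : EuclideanSpace ℝ (Fin d)) :
    quadForm (a • vecMulVec u.ofLp u.ofLp) x = a * ⟪u, x⟫ ^ 2 := by
  rw [quadForm, smul_mulVec, vecMulVec_mulVec, dotProduct_smul, dotProduct_smul,
    dotProduct_comm x.ofLp, ofLp_dotProduct_ofLp_eq_inner]
  simp [sq]

theorem lemma3 {Ω Ω' : Type*} [MeasurableSpace Ω] [MeasurableSpace Ω']
    (P : Measure Ω) [IsProbabilityMeasure P] (P' : Measure Ω') [IsProbabilityMeasure P']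
    (d : ℕ) (hd : 2 ≤ d)
    (s : Ω → EuclideanSpace ℝ (Fin d)) (hs : HasLaw s (sphereUniform d) P)
    (u : EuclideanSpace ℝ (Fin d)) (hu : ‖u‖ = 1)
    (lmax : ℝ) (hlmax : 0 < lmax)
    (G : Matrix (Fin d) (Fin d) ℝ) (hG : G = lmax • vecMulVec u.ofLp u.ofLp) :
    -- `sᵀ G s / λ_max = (uᵀ s)²`
    (∀ ω, quadForm G (s ω) / lmax = (u.ofLp ⬝ᵥ (s ω).ofLp) ^ 2) ∧
    -- `(uᵀ s)²` has the law of `s₁²`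
    IdentDistrib (fun ω => (u.ofLp ⬝ᵥ (s ω).ofLp) ^ 2)
      (fun ω => (s ω ⟨0, by omega⟩) ^ 2) P P ∧
    -- both have the law `Beta(1/2, (d-1)/2)`
    HasLaw (fun ω => (s ω ⟨0, by omega⟩) ^ 2) (betaMeasure (1 / 2) (((d : ℝ) - 1) / 2)) P ∧
    HasLaw (fun ω => (u.ofLp ⬝ᵥ (s ω).ofLp) ^ 2)
      (betaMeasure (1 / 2) (((d : ℝ) - 1) / 2)) P ∧
    -- the scaled vector `c = m s`, of norm `m`
    (∀ (m : ℝ), 0 < m → ∀ c : Ω → EuclideanSpace ℝ (Fin d), (∀ ω, c ω = m • s ω) →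
      (∀ᵐ ω ∂P, ‖c ω‖ = m) ∧
      (∀ Z : Ω → ℝ, HasLaw Z (betaMeasure (1 / 2) (((d : ℝ) - 1) / 2)) P →
        IdentDistrib (fun ω => quadForm G (c ω)) (fun ω => lmax * ‖c ω‖ ^ 2 * Z ω) P P) ∧
      (∀ Z : Ω' → ℝ, HasLaw Z (betaMeasure (1 / 2) (((d : ℝ) - 1) / 2)) P' →
        IdentDistrib (fun ω => quadForm G (c ω)) (fun ω' => lmax * m ^ 2 * Z ω') P P')) := by
  simp only [ofLp_dotProduct_ofLp_eq_inner, hG, quadForm_smul_vecMulVec]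
  have law_u := (hasLaw_inner_sq_sphereUniform hd hu).fun_comp hs
  have law_0 : HasLaw (fun ω => (s ω ⟨0, by omega⟩) ^ 2)
      (betaMeasure (1 / 2) (((d : ℝ) - 1) / 2)) P := by
    simpa [EuclideanSpace.inner_single_left] using (hasLaw_inner_sq_sphereUniform hd
      (u := EuclideanSpace.single ⟨0, by omega⟩ 1) (by simp)).fun_comp hs
  refine ⟨fun ω => by field_simp, law_u.identDistrib law_0, law_0, law_u, fun m hm c hc => ?_⟩
  have norm_c : ∀ᵐ ω ∂P, ‖c ω‖ = m := by
    have : ∀ᵐ ω ∂P, ‖s ω‖ = 1 :=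
      (hs.ae_iff (p := fun x => ‖x‖ = 1) (measurableSet_eq_fun (by fun_prop) (by fun_prop)).mem).2
        (ae_sphereUniform_norm_eq_one d)
    filter_upwards [this] with ω hω
    rw [hc, norm_smul, hω, mul_one, Real.norm_of_nonneg hm.le]
  have form_c : (fun ω => lmax * ⟪u, c ω⟫ ^ 2) = fun ω => lmax * m ^ 2 * ⟪u, s ω⟫ ^ 2 := by
    funext ω
    rw [hc, inner_smul_right]
    ring
  rw [form_c]
  refine ⟨norm_c, fun Z hZ => ?_, fun Z hZ => (law_u.identDistrib hZ).const_mul _⟩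
  -- Since `‖c ω‖ = m` almost surely, the norm acts as a constant, so the joint law of `Z` and `s`
  -- is irrelevant.
  refine ((law_u.identDistrib hZ).const_mul _).trans
    (IdentDistrib.of_ae_eq (hZ.aemeasurable.const_mul _) ?_)
  filter_upwards [norm_c] with ω hω
  rw [hω]
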